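/- Let $K$ be a field and let $A=\bigoplus_{n\ge 0}A_n$ and $B=\bigoplus_{n\ge 0}B_n$ be graded associative unital $K$-algebras that are connected (that is, $A_0=K\cdot 1\neq 0$ and $B_0=K\cdot 1\neq 0$) and whose homogeneous components are all finite-dimensional. Let $A=K\langle X\mid R\rangle$ and $B=K\langle Y\mid S\rangle$ be any presentations by generators and relations, and let $A*B=K\langle X\sqcup Y\mid R\cup S\rangle$ be the free product, that is, the algebra generated by the disjoint union of the generators, with both sets of relations. For $n\ge 0$ let $(A*B)_n$ be the subspace spanned by all products of (images of) homogeneous elements of $A$ and $B$ whose degrees add up to $n$. Then $A*B=\bigoplus_{n\ge 0}(A*B)_n$ is a graded algebra, it is connected, its components are finite-dimensional, and the Hilbert series $H_C=\sum_{n\ge 0}\dim_K(C_n)\,t^n\in\mathbb{Q}[[t]]$ of these graded algebras satisfy $$H_{A*B}^{-1}=H_A^{-1}+H_B^{-1}-1 .$$ -/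

import Mathlib

namespace FreeProductHilbert

/-- The algebra `K⟨X | R⟩` with generators `X` and relations `f = 0` for `f ∈ R`: the quotient of
the free associative unital algebra `K⟨X⟩` by the two-sided ideal generated by `R`. -/
abbrev PresentedAlgebra (K : Type*) [Field K] {X : Type*} (R : Set (FreeAlgebra K X)) : Type _ :=
  RingQuot (fun f g : FreeAlgebra K X => f ∈ R ∧ g = 0)

/-- A presentation of the algebra `A` by generators and relations: a type of generators, a set of
relations, and an isomorphism of `A` with the algebra so presented. -/
structure Presentation (K : Type*) [Field K] (A : Type*) [Ring A] [Algebra K A] where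
  /-- the generators -/
  Gen : Type*
  /-- the relations (each `f` stands for `f = 0`) -/
  rels : Set (FreeAlgebra K Gen)
  /-- the identification of the presented algebra with `A` -/
  equiv : PresentedAlgebra K rels ≃ₐ[K] A

section

variable {K : Type*} [Field K] {A : Type*} [Ring A] [Algebra K A]
  {B : Type*} [Ring B] [Algebra K B]

/-- The map of free algebras `K⟨X⟩ → K⟨Y⟩` induced by a map `X → Y` of generators. -/
noncomputable def freeMap (K : Type*) [Field K] {X Y : Type*} (φ : X → Y) :
    FreeAlgebra K X →ₐ[K] FreeAlgebra K Y :=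
  FreeAlgebra.lift K (fun x => FreeAlgebra.ι K (φ x))

/-- Both sets of relations, written in the disjoint union of the two sets of generators. -/
def unionRels (P : Presentation K A) (Q : Presentation K B) :
    Set (FreeAlgebra K (P.Gen ⊕ Q.Gen)) :=
  (freeMap K Sum.inl '' P.rels) ∪ (freeMap K Sum.inr '' Q.rels)

/-- The free product `A * B`: the disjoint union of the generators, with both sets of relations. -/
abbrev FreeProd (P : Presentation K A) (Q : Presentation K B) : Type _ :=
  PresentedAlgebra K (unionRels P Q)

/-- The canonical homomorphism `A → A * B`, sending each generator of `A` to itself. -/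
noncomputable def inl (P : Presentation K A) (Q : Presentation K B) : A →ₐ[K] FreeProd P Q :=
  (RingQuot.liftAlgHom K
    ⟨(RingQuot.mkAlgHom K (fun f g => f ∈ unionRels P Q ∧ g = 0)).comp (freeMap K Sum.inl), by
      rintro f g ⟨hf, rfl⟩
      simp only [AlgHom.comp_apply, map_zero]
      rw [← map_zero (RingQuot.mkAlgHom K (fun f g => f ∈ unionRels P Q ∧ g = 0))]
      exact RingQuot.mkAlgHom_rel K ⟨Or.inl ⟨f, hf, rfl⟩, rfl⟩⟩).comp
    P.equiv.symm.toAlgHom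

/-- The canonical homomorphism `B → A * B`, sending each generator of `B` to itself. -/
noncomputable def inr (P : Presentation K A) (Q : Presentation K B) : B →ₐ[K] FreeProd P Q :=
  (RingQuot.liftAlgHom K
    ⟨(RingQuot.mkAlgHom K (fun f g => f ∈ unionRels P Q ∧ g = 0)).comp (freeMap K Sum.inr), by
      rintro f g ⟨hf, rfl⟩
      simp only [AlgHom.comp_apply, map_zero]
      rw [← map_zero (RingQuot.mkAlgHom K (fun f g => f ∈ unionRels P Q ∧ g = 0))]
      exact RingQuot.mkAlgHom_rel K ⟨Or.inr ⟨f, hf, rfl⟩, rfl⟩⟩).comp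
    Q.equiv.symm.toAlgHom

/-- `IsWord P Q 𝒜 ℬ n x`: the element `x` of `A * B` is a (possibly empty) product of homogeneous
elements of `A` and of `B` whose degrees add up to `n`. -/
inductive IsWord (P : Presentation K A) (Q : Presentation K B)
    (𝒜 : ℕ → Submodule K A) (ℬ : ℕ → Submodule K B) : ℕ → FreeProd P Q → Prop
  | one : IsWord P Q 𝒜 ℬ 0 1
  | left {m n : ℕ} {a : A} {x : FreeProd P Q} (ha : a ∈ 𝒜 m) (hx : IsWord P Q 𝒜 ℬ n x) :
      IsWord P Q 𝒜 ℬ (m + n) (inl P Q a * x)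
  | right {m n : ℕ} {b : B} {x : FreeProd P Q} (hb : b ∈ ℬ m) (hx : IsWord P Q 𝒜 ℬ n x) :
      IsWord P Q 𝒜 ℬ (m + n) (inr P Q b * x)

/-- The grading of `A * B` induced by the gradings of `A` and `B`: the component of degree `n` is
spanned by the products of homogeneous elements of `A` and `B` of total degree `n`. -/
def freeProdGrading (P : Presentation K A) (Q : Presentation K B)
    (𝒜 : ℕ → Submodule K A) (ℬ : ℕ → Submodule K B) (n : ℕ) : Submodule K (FreeProd P Q) :=
  Submodule.span K {x | IsWord P Q 𝒜 ℬ n x}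

/-- A graded algebra is connected if its component of degree `0` is the ground field `K · 1 ≠ 0`. -/
def IsConnectedGrading (𝒜 : ℕ → Submodule K A) : Prop :=
  Nontrivial A ∧ 𝒜 0 = 1

/-- The Hilbert series `∑ dim(Aₙ) tⁿ`, for a grading with finite-dimensional components. -/
noncomputable def hilbertSeries (𝒜 : ℕ → Submodule K A) : PowerSeries ℚ :=
  PowerSeries.mk (fun n => (Module.finrank K (𝒜 n) : ℚ))

end

end FreeProductHilbert

namespace FreeProductHilbert

open Module

/-! Choose homogeneous bases of `A` and `B` containing `1`. The alternating words in the remaining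
basis elements form a homogeneous basis of `A * B` (`wordBasis`, `isHomogeneousBasis_wordBasis`), so
the Hilbert series counts words by degree. That they form a basis is van der Waerden's argument.
Each word is uniquely an optional letter of `A` followed by a word not beginning with one, so the
space `V` of words is a free `A`-module, and likewise a free `B`-module. By the universal property
`A * B` acts on `V` (`wordRep`). Acting on the empty word is inverse to multiplying out words:
`wordRep_val` gives one composite, the equivariance `valMap_wordRep` the other. For the count, let
`W` be the series of all words and `W_A`, `W_B` those of words not beginning with a letter of `A`,
resp. `B`. Then `H_A W_A = W = H_B W_B` (`countSeries_mul`) and `W_A + W_B = W + 1`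
(`countSeries_add`), since only the empty word is counted twice. Dividing by `W` gives the formula.
-/

/-! ### Alternating words -/

/-- Words in the letters `Σ c, L c` in which neighbouring letters come from different alphabets.
The words in `AltWord L (some c)` moreover do not begin with a letter from the alphabet `L c`. -/
inductive AltWord {ι : Type} (L : ι → Type) : Option ι → Type
  | nil {b : Option ι} : AltWord L b
  | cons {b : Option ι} (c : ι) (h : some c ≠ b) (i : L c) (w : AltWord L (some c)) : AltWord L b

namespace AltWord

variable {ι : Type} {L : ι → Type}

/-- Forget that a word does not begin with a letter from a certain alphabet. -/
def forget {b : Option ι} : AltWord L b → AltWord L none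
  | nil => nil
  | cons c _ i w => cons c (Option.some_ne_none c) i w

/-- The degree of a word is the sum of the degrees of its letters. -/
def deg (d : ∀ c, L c → ℕ) : {b : Option ι} → AltWord L b → ℕ
  | _, nil => 0
  | _, cons c _ i w => d c i + deg d w

/-- The product of the letters of a word. -/
def val {M : Type*} [Monoid M] (f : ∀ c, L c → M) : {b : Option ι} → AltWord L b → M
  | _, nil => 1
  | _, cons c _ i w => f c i * val f w

theorem forget_injective {b : Option ι} : Function.Injective (forget (L := L) (b := b)) := by
  intro w w' h
  cases w <;> cases w' <;> simp_all [forget]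

/-- A word which does not begin with a letter of the alphabet `L c` indeed does not do so. -/
theorem forget_ne_cons {c : ι} (w w' : AltWord L (some c)) (i : L c) :
    w.forget ≠ cons c (Option.some_ne_none c) i w' := by
  intro h
  cases w with
  | nil => simp [forget] at h
  | cons c' h' i w =>
    obtain ⟨rfl, -⟩ := (cons.injEq ..).mp h
    exact h' rfl

theorem val_forget {M : Type*} [Monoid M] (f : ∀ c, L c → M) {b : Option ι} (w : AltWord L b) :
    val f w.forget = val f w := by
  cases w <;> rfl

theorem deg_forget (d : ∀ c, L c → ℕ) {b : Option ι} (w : AltWord L b) :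
    deg d w.forget = deg d w := by
  cases w <;> rfl

theorem eq_nil_of_deg_eq_zero {d : ∀ c, L c → ℕ} (hd : ∀ c i, d c i ≠ 0) {b : Option ι}
    {w : AltWord L b} (hw : deg d w = 0) : w = nil := by
  cases w with
  | nil => rfl
  | cons c h i w => exact absurd (Nat.eq_zero_of_add_eq_zero_right hw) (hd c i)

/-- Put an optional letter from the alphabet `L c` in front of a word which does not begin with
such a letter. -/
def prepend (c : ι) : Option (L c) × AltWord L (some c) → AltWord L none
  | (none, w) => w.forget
  | (some i, w) => cons c (Option.some_ne_none c) i w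

theorem prepend_bijective (c : ι) : Function.Bijective (prepend (L := L) c) := by
  constructor
  · rintro ⟨_ | i, w⟩ ⟨_ | i', w'⟩ h
    · rw [forget_injective (show w.forget = w'.forget from h)]
    · exact absurd h (forget_ne_cons w w' i')
    · exact absurd h.symm (forget_ne_cons w' w i)
    · simp_all [prepend]
  · intro w
    cases w with
    | nil => exact ⟨(none, nil), rfl⟩
    | cons c' h i w =>
      by_cases hc : c' = c
      · subst hc
        exact ⟨(some i, w), rfl⟩
      · exact ⟨(none, cons c' (by simpa using hc) i w), rfl⟩

/-- Every word is, in a unique way, an optional letter from the alphabet `L c` followed by a word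
which does not begin with such a letter. -/
noncomputable def prependEquiv (L : ι → Type) (c : ι) :
    Option (L c) × AltWord L (some c) ≃ AltWord L none :=
  Equiv.ofBijective _ (prepend_bijective c)

theorem deg_prepend (d : ∀ c, L c → ℕ) (c : ι) (x : Option (L c)) (w : AltWord L (some c)) :
    deg d (prependEquiv L c (x, w)) = x.elim 0 (d c) + deg d w := by
  cases x
  · exact (deg_forget d w).trans (zero_add _).symm
  · rfl

/-- For two alphabets, the words together with an extra empty word are the words not beginning
with a letter of the one alphabet, together with those not beginning with one of the other. -/
def sumToSum (L : Bool → Type) :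
    AltWord L (some true) ⊕ AltWord L (some false) → AltWord L none ⊕ Unit
  | Sum.inl w => Sum.inl w.forget
  | Sum.inr nil => Sum.inr ()
  | Sum.inr (cons c _ i w) => Sum.inl (cons c (Option.some_ne_none c) i w)

theorem sumToSum_bijective (L : Bool → Type) : Function.Bijective (sumToSum L) := by
  constructor
  · rintro (w | (_ | ⟨c, h, i, w⟩)) (w' | (_ | ⟨c', h', i', w'⟩)) hw
    · rw [forget_injective (Sum.inl.inj hw)]
    · cases hw
    -- Only here and in the parallel case below does injectivity need that there are just two
    -- alphabets.
    · obtain rfl : c' = true := by simpa using h'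
      exact absurd (Sum.inl.inj hw) (forget_ne_cons w w' i')
    · cases hw
    · rfl
    · cases hw
    · obtain rfl : c = true := by simpa using h
      exact absurd (Sum.inl.inj hw).symm (forget_ne_cons w' w i)
    · cases hw
    · cases hw
      rfl
  · rintro ((_ | ⟨c, h, i, w⟩) | _)
    · exact ⟨Sum.inl nil, rfl⟩
    · cases c
      · exact ⟨Sum.inl (cons false (by simp) i w), rfl⟩
      · exact ⟨Sum.inr (cons true (by simp) i w), rfl⟩
    · exact ⟨Sum.inr nil, rfl⟩

theorem deg_sumToSum {L : Bool → Type} (d : ∀ c, L c → ℕ)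
    (x : AltWord L (some true) ⊕ AltWord L (some false)) :
    (sumToSum L x).elim (deg d) (fun _ => 0) = x.elim (deg d) (deg d) := by
  rcases x with w | (_ | ⟨c, h, i, w⟩)
  · exact deg_forget d w
  · rfl
  · rfl

/-- Letters have positive degree, so removing the first one lowers the degree by at least one.
Bounding the degree instead of fixing it makes ordinary induction suffice. -/
theorem finite_deg_le [Finite ι] {d : ∀ c, L c → ℕ} (hd : ∀ c i, d c i ≠ 0)
    (hfin : ∀ c n, {i | d c i = n}.Finite) (n : ℕ) (b : Option ι) :
    {w : AltWord L b | deg d w ≤ n}.Finite := by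
  induction n generalizing b with
  | zero =>
    refine (Set.finite_singleton nil).subset fun w hw => ?_
    exact eq_nil_of_deg_eq_zero hd (Nat.le_zero.mp hw)
  | succ n ih =>
    have hfin' (c : ι) : {i | d c i ≤ n + 1}.Finite := by
      refine ((Set.finite_Iic (n + 1)).biUnion fun m _ => hfin c m).subset fun i hi => ?_
      simpa using hi
    have key : (⋃ p : {c : ι // some c ≠ b}, Set.image2 (fun i w => cons p.1 p.2 i w)
        {i | d p.1 i ≤ n + 1} {w | deg d w ≤ n}).Finite :=
      Set.finite_iUnion fun p => (hfin' p.1).image2 _ (ih (some p.1))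
    refine (key.insert nil).subset fun w hw => ?_
    cases w with
    | nil => exact Set.mem_insert _ _
    | cons c h i w =>
      have h1 : d c i + deg d w ≤ n + 1 := hw
      have h2 := hd c i
      refine Or.inr (Set.mem_iUnion.mpr ⟨⟨c, h⟩, i, ?_, w, ?_, rfl⟩)
      · show d c i ≤ n + 1
        omega
      · show deg d w ≤ n
        omega

theorem finite_deg_eq [Finite ι] {d : ∀ c, L c → ℕ} (hd : ∀ c i, d c i ≠ 0)
    (hfin : ∀ c n, {i | d c i = n}.Finite) (b : Option ι) (n : ℕ) :
    {w : AltWord L b | deg d w = n}.Finite :=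
  (finite_deg_le hd hfin n b).subset fun _ hw => le_of_eq hw

end AltWord

/-! ### Generating functions -/

/-- The generating function counting the elements of a set by their degrees. -/
noncomputable def countSeries {S : Type*} (d : S → ℕ) : PowerSeries ℚ :=
  PowerSeries.mk fun n => (Nat.card {s // d s = n} : ℚ)

theorem countSeries_congr {S T : Type*} {d : S → ℕ} {d' : T → ℕ} (e : S ≃ T)
    (h : ∀ s, d' (e s) = d s) : countSeries d = countSeries d' := by
  ext n
  simp only [countSeries, PowerSeries.coeff_mk]
  exact congrArg _ (Nat.card_congr (e.subtypeEquiv fun s => by rw [h]))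

/-- Sorting pairs by their two degrees gives the Cauchy product. Finite fibres are required because
`Nat.card` is `0` on infinite types. -/
theorem countSeries_prod {S T : Type*} {d : S → ℕ} {d' : T → ℕ}
    (hd : ∀ n, {s | d s = n}.Finite) (hd' : ∀ n, {t | d' t = n}.Finite) :
    countSeries (fun p : S × T => d p.1 + d' p.2) = countSeries d * countSeries d' := by
  ext n
  have (n : ℕ) : Finite {s // d s = n} := hd n
  have (n : ℕ) : Finite {s // d' s = n} := hd' n
  let e : {p : S × T // d p.1 + d' p.2 = n} ≃
      Σ q : Finset.HasAntidiagonal.antidiagonal n, {s // d s = q.1.1} × {t // d' t = q.1.2} :=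
    { toFun := fun p => ⟨⟨(d p.1.1, d' p.1.2), Finset.HasAntidiagonal.mem_antidiagonal.mpr p.2⟩,
        ⟨p.1.1, rfl⟩, ⟨p.1.2, rfl⟩⟩
      invFun := fun x => ⟨(x.2.1.1, x.2.2.1), by
        rw [x.2.1.2, x.2.2.2]; exact Finset.HasAntidiagonal.mem_antidiagonal.mp x.1.2⟩
      left_inv := fun p => rfl
      right_inv := by
        rintro ⟨⟨⟨a, b⟩, h⟩, ⟨s, hs⟩, ⟨t, ht⟩⟩
        change d s = a at hs
        change d' t = b at ht
        subst hs ht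
        rfl }
  simp only [countSeries, PowerSeries.coeff_mk, PowerSeries.coeff_mul]
  rw [Nat.card_congr e, Nat.card_sigma, Nat.cast_sum, Finset.univ_eq_attach,
    Finset.sum_attach (Finset.HasAntidiagonal.antidiagonal n)
      (fun q => ((Nat.card ({s // d s = q.1} × {t // d' t = q.2}) : ℕ) : ℚ))]
  simp [Nat.card_prod]

theorem countSeries_sum {S T : Type*} {d : S → ℕ} {d' : T → ℕ}
    (hd : ∀ n, {s | d s = n}.Finite) (hd' : ∀ n, {t | d' t = n}.Finite) :
    countSeries (Sum.elim d d') = countSeries d + countSeries d' := by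
  ext n
  have : Finite {s // d s = n} := hd n
  have : Finite {s // d' s = n} := hd' n
  simp only [countSeries, PowerSeries.coeff_mk, map_add]
  rw [Nat.card_congr (Equiv.subtypeSum (p := fun x => Sum.elim d d' x = n))]
  simp only [Sum.elim_inl, Sum.elim_inr]
  rw [Nat.card_sum, Nat.cast_add]

theorem countSeries_unit : countSeries (fun _ : Unit => 0) = 1 := by
  ext n
  simp only [countSeries, PowerSeries.coeff_mk, PowerSeries.coeff_one]
  rcases eq_or_ne n 0 with rfl | hn
  · simp
  · simp [hn, hn.symm]

namespace AltWord

variable {L : Bool → Type} {d : ∀ c, L c → ℕ}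

theorem countSeries_mul {ι : Type} [Finite ι] {L : ι → Type} {d : ∀ c, L c → ℕ}
    (hd : ∀ c i, d c i ≠ 0) (hfin : ∀ c n, {i | d c i = n}.Finite) (c : ι) :
    countSeries (fun x : Option (L c) => x.elim 0 (d c)) *
      countSeries (deg d (b := some c)) = countSeries (deg d (b := none)) := by
  have hfin' (n : ℕ) : {x : Option (L c) | x.elim 0 (d c) = n}.Finite := by
    refine (((hfin c n).image some).insert none).subset ?_
    rintro (_ | i) hi
    · exact Set.mem_insert _ _
    · exact Or.inr ⟨i, hi, rfl⟩
  rw [← countSeries_prod hfin' (finite_deg_eq hd hfin (some c))]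
  exact countSeries_congr (prependEquiv L c) fun p => deg_prepend d c p.1 p.2

theorem countSeries_add (hd : ∀ c i, d c i ≠ 0) (hfin : ∀ c n, {i | d c i = n}.Finite) :
    countSeries (deg d (b := some true)) + countSeries (deg d (b := some false)) =
      countSeries (deg d (b := none)) + 1 := by
  rw [← countSeries_sum (finite_deg_eq hd hfin _) (finite_deg_eq hd hfin _), ← countSeries_unit,
    ← countSeries_sum (finite_deg_eq hd hfin _)
      (fun n => Set.toFinite {t : Unit | (fun _ : Unit => 0) t = n})]
  exact countSeries_congr (Equiv.ofBijective _ (sumToSum_bijective L)) (deg_sumToSum d)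

theorem inv_countSeries (hd : ∀ c i, d c i ≠ 0) (hfin : ∀ c n, {i | d c i = n}.Finite) :
    (countSeries (deg d (b := none)))⁻¹ =
      (countSeries (fun x : Option (L true) => x.elim 0 (d true)))⁻¹ +
      (countSeries (fun x : Option (L false) => x.elim 0 (d false)))⁻¹ - 1 := by
  have hne (c : Bool) : PowerSeries.constantCoeff
      (countSeries (fun x : Option (L c) => x.elim 0 (d c))) ≠ 0 := by
    -- Only `none`, standing for `1`, has degree `0`; the constant term is thus `1` and the inverse
    -- is genuine.
    have : Unique {x : Option (L c) // x.elim 0 (d c) = 0} :=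
      { default := ⟨none, rfl⟩
        uniq := by
          rintro ⟨_ | i, hi⟩
          · rfl
          · exact absurd hi (hd c i) }
    rw [← PowerSeries.coeff_zero_eq_constantCoeff_apply]
    simp [countSeries]
  have key : countSeries (deg d (b := none)) *
      ((countSeries (fun x : Option (L true) => x.elim 0 (d true)))⁻¹ +
      (countSeries (fun x : Option (L false) => x.elim 0 (d false)))⁻¹ - 1) = 1 := by
    have h1 := PowerSeries.mul_inv_cancel _ (hne true)
    have h2 := PowerSeries.mul_inv_cancel _ (hne false)
    have h3 := countSeries_mul hd hfin true
    have h4 := countSeries_mul hd hfin false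
    have h5 := countSeries_add hd hfin
    rw [mul_sub, mul_add]
    -- Each of the two products gets its own factorization of the word series, cancelling the
    -- respective inverse; the subtracted copy stays intact.
    nth_rewrite 1 [← h3]
    nth_rewrite 1 [← h4]
    rw [mul_right_comm, h1, mul_right_comm, h2, one_mul, one_mul, h5]
    ring
  rw [eq_comm, PowerSeries.eq_inv_iff_mul_eq_one, mul_comm]
  · exact key
  · intro h0
    simpa [h0] using congrArg PowerSeries.constantCoeff key

end AltWord

/-! ### Homogeneous bases -/

section Homogeneous

variable {K : Type*} [Field K] {A : Type*} [Ring A] [Algebra K A] {𝒜 : ℕ → Submodule K A}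
  {W : Type*}

/-- The part of a basis in a subset of the index set, as a basis of its span. -/
noncomputable def basisSpanImage (b : Basis W K A) (s : Set W) :
    Basis s K (Submodule.span K (b '' s)) :=
  (Basis.span (b.linearIndependent.comp ((↑) : s → W) Subtype.val_injective)).map
    (LinearEquiv.ofEq _ _ (by rw [Set.range_comp, Subtype.range_coe]))

/-- The basis `b` consists of homogeneous elements, where `b w` has degree `d w`. -/
def IsHomogeneousBasis (𝒜 : ℕ → Submodule K A) (b : Basis W K A) (d : W → ℕ) : Prop :=
  ∀ n, 𝒜 n = Submodule.span K (b '' {w | d w = n})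

namespace IsHomogeneousBasis

variable {b : Basis W K A} {d : W → ℕ} (h : IsHomogeneousBasis 𝒜 b d)

include h

theorem mem (w : W) : b w ∈ 𝒜 (d w) := by
  rw [h]
  exact Submodule.subset_span ⟨w, rfl, rfl⟩

theorem hilbertSeries_eq : hilbertSeries 𝒜 = countSeries d := by
  ext n
  simp only [hilbertSeries, countSeries, PowerSeries.coeff_mk]
  rw [h, Module.finrank_eq_nat_card_basis (basisSpanImage b {w | d w = n})]
  rfl

theorem finite_iff (n : ℕ) : Module.Finite K (𝒜 n) ↔ {w | d w = n}.Finite := by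
  rw [h]
  constructor
  · intro _
    exact Module.Finite.finite_basis (basisSpanImage b {w | d w = n})
  · intro hn
    have : Finite {w | d w = n} := hn
    exact Module.Finite.of_basis (basisSpanImage b {w | d w = n})

/-- A space with a homogeneous basis is the direct sum of its homogeneous components. -/
noncomputable abbrev decomposition : DirectSum.Decomposition 𝒜 :=
  DirectSum.Decomposition.ofLinearMap 𝒜
    (b.constr K fun w => DirectSum.lof K ℕ (fun n => 𝒜 n) (d w) ⟨b w, h.mem w⟩)
    (b.ext fun w => by simp)
    (by
      refine DirectSum.linearMap_ext K fun n => LinearMap.ext fun x => ?_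
      obtain ⟨x, hx⟩ := x
      simp only [LinearMap.comp_apply, DirectSum.coeLinearMap_lof, LinearMap.id_apply]
      have hx' := hx
      rw [h] at hx'
      induction hx' using Submodule.span_induction with
      | mem x hxm =>
        obtain ⟨w, rfl, rfl⟩ := hxm
        simp
      | zero =>
        rw [map_zero]
        exact (map_zero (DirectSum.lof K ℕ (fun n => 𝒜 n) n)).symm
      | add x y hxs hys ihx ihy =>
        rw [map_add, ihx ((h n).ge hxs), ihy ((h n).ge hys), ← map_add]
        rfl
      | smul r x hxs ih =>
        rw [map_smul, ih ((h n).ge hxs), ← map_smul]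
        rfl)

end IsHomogeneousBasis

/-- A connected graded algebra has a homogeneous basis in which `1` is the only element of
degree `0`. -/
theorem exists_isHomogeneousBasis [GradedAlgebra 𝒜] (h𝒜 : IsConnectedGrading 𝒜)
    (hfin : ∀ n, Module.Finite K (𝒜 n)) :
    ∃ (I : Type) (b : Basis (Option I) K A) (d : I → ℕ), (∀ i, d i ≠ 0) ∧ b none = 1 ∧
      IsHomogeneousBasis 𝒜 b (fun x => x.elim 0 d) := by
  obtain ⟨hnt, h0⟩ := h𝒜
  have hone : (1 : A) ∈ 𝒜 0 := SetLike.GradedOne.one_mem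
  have hrank : finrank K (𝒜 0) = 1 := by
    refine finrank_eq_one (⟨1, hone⟩ : 𝒜 0) (by simp [Subtype.ext_iff]) ?_
    rintro ⟨x, hx⟩
    rw [h0] at hx
    obtain ⟨c, rfl⟩ := Submodule.mem_one.mp hx
    exact ⟨c, Subtype.ext (by simp [Algebra.algebraMap_eq_smul_one])⟩
  -- The implication forces the basis vector in degree `0` to be `1` itself, while keeping the
  -- choice uniform in `n`.
  have hbas (n : ℕ) : ∃ v : Basis (Fin (finrank K (𝒜 n))) K (𝒜 n),
      n = 0 → ∀ i, ((v i : 𝒜 n) : A) = 1 := by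
    rcases eq_or_ne n 0 with rfl | hn
    · have : Unique (Fin (finrank K (𝒜 0))) := hrank ▸ (inferInstance : Unique (Fin 1))
      refine ⟨FiniteDimensional.basisSingleton _ hrank ⟨1, hone⟩ (by simp [Subtype.ext_iff]), fun _ i => ?_⟩
      rw [FiniteDimensional.basisSingleton_apply]
    · exact ⟨finBasis K (𝒜 n), fun h => absurd h hn⟩
  choose v hv using hbas
  have hint := DirectSum.Decomposition.isInternal 𝒜
  let x₀ : Σ n, Fin (finrank K (𝒜 n)) := ⟨0, ⟨0, by rw [hrank]; exact one_pos⟩⟩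
  let e : Option {x // x ≠ x₀} ≃ Σ n, Fin (finrank K (𝒜 n)) := Equiv.optionSubtypeNe x₀
  have hdeg (x : Option {x // x ≠ x₀}) : x.elim 0 (fun i => i.1.1) = (e x).1 := by
    cases x <;> rfl
  refine ⟨{x // x ≠ x₀}, (hint.collectedBasis v).reindex e.symm, fun i => i.1.1, ?_, ?_, ?_⟩
  · rintro ⟨⟨n, k⟩, hk⟩ (rfl : n = 0)
    refine hk (congrArg (Sigma.mk 0) (Fin.ext ?_))
    have := k.2
    show k.1 = 0
    omega
  · rw [Basis.reindex_apply, Equiv.symm_symm, hint.collectedBasis_coe]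
    exact hv 0 rfl _
  · intro n
    apply le_antisymm
    · intro a ha
      have h1 : (⟨a, ha⟩ : 𝒜 n) ∈ Submodule.span K (Set.range (v n)) := by
        rw [(v n).span_eq]
        trivial
      have h2 := Submodule.mem_map_of_mem (f := (𝒜 n).subtype) h1
      rw [Submodule.map_span] at h2
      refine Submodule.span_mono ?_ h2
      rintro _ ⟨_, ⟨k, rfl⟩, rfl⟩
      refine ⟨e.symm ⟨n, k⟩, ?_, ?_⟩
      · show Option.elim _ _ _ = _
        rw [hdeg, Equiv.apply_symm_apply]
      · rw [Basis.reindex_apply, Equiv.symm_symm, Equiv.apply_symm_apply,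
          hint.collectedBasis_coe]
        rfl
    · rw [Submodule.span_le]
      rintro _ ⟨x, hx, rfl⟩
      change Option.elim _ _ _ = _ at hx
      rw [hdeg] at hx
      rw [Basis.reindex_apply, Equiv.symm_symm, ← hx]
      exact hint.collectedBasis_mem v _

end Homogeneous

/-! ### The action of an algebra on words -/

section Action

variable {K : Type*} [Field K] {A : Type*} [Ring A] [Algebra K A] {I N W : Type*}
  (b : Basis (Option I) K A) (e : Option I × N ≃ W)

/-- If `W ≃ Option I × N` and `A` has a basis indexed by `Option I`, then the vector space with
basis `W` is a free `A`-module with basis `N`. -/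
noncomputable def wordEquiv : (N →₀ A) ≃ₗ[K] (W →₀ K) :=
  ((Finsupp.basis fun _ : N => b).reindex
    ((Equiv.sigmaEquivProd N (Option I)).trans ((Equiv.prodComm N (Option I)).trans e))).repr

theorem wordEquiv_single (n : N) (x : Option I) :
    wordEquiv b e (Finsupp.single n (b x)) = Finsupp.single (e (x, n)) 1 := by
  have := ((Finsupp.basis fun _ : N => b).reindex
    ((Equiv.sigmaEquivProd N (Option I)).trans
      ((Equiv.prodComm N (Option I)).trans e))).repr_self (e (x, n))
  rw [← this, wordEquiv]
  congr 1
  simp [Basis.reindex_apply]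

/-- The action of `A` on the vector space with basis `W`, regarded as a free `A`-module. -/
noncomputable def wordAction : A →ₐ[K] Module.End K (W →₀ K) :=
  ((wordEquiv b e).conjAlgEquiv K).toAlgHom.comp (Algebra.lsmul K K (N →₀ A))

theorem wordAction_wordEquiv (a : A) (f : N →₀ A) :
    wordAction b e a (wordEquiv b e f) = wordEquiv b e (a • f) := by
  simp [wordAction, LinearEquiv.conjAlgEquiv_apply]

theorem wordAction_single (hb : b none = 1) (x : Option I) (n : N) :
    wordAction b e (b x) (Finsupp.single (e (none, n)) 1) = Finsupp.single (e (x, n)) 1 := by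
  rw [← wordEquiv_single b e, wordAction_wordEquiv, hb, Finsupp.smul_single, smul_eq_mul, mul_one,
    wordEquiv_single]

/-- A linear map which is compatible with the action on basis elements is equivariant. -/
theorem map_wordAction {C : Type*} [Ring C] [Algebra K C] (j : A →ₐ[K] C) (u : N → C)
    (Ψ : (W →₀ K) →ₗ[K] C)
    (hΨ : ∀ x n, Ψ (Finsupp.single (e (x, n)) 1) = j (b x) * u n) (a : A) (v : W →₀ K) :
    Ψ (wordAction b e a v) = j a * Ψ v := by
  -- On the `n`-th copy of `A` the map `Ψ` is `j` followed by right multiplication by `u n`; this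
  -- commutes with left multiplication.
  have key (n : N) (a : A) : Ψ (wordEquiv b e (Finsupp.single n a)) = j a * u n := by
    have : (Ψ ∘ₗ (wordEquiv b e).toLinearMap ∘ₗ Finsupp.lsingle n : A →ₗ[K] C) =
        (LinearMap.mulRight K (u n) ∘ₗ j.toLinearMap : A →ₗ[K] C) :=
      b.ext fun x => by simp [wordEquiv_single, hΨ]
    exact LinearMap.congr_fun this a
  obtain ⟨f, rfl⟩ := (wordEquiv b e).surjective v
  rw [wordAction_wordEquiv]
  induction f using Finsupp.induction_linear with
  | zero => simp
  | add f g hf hg => simp only [smul_add, map_add, hf, hg, mul_add]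
  | single n a' => rw [Finsupp.smul_single, key, key, smul_eq_mul, map_mul, mul_assoc]

/-- The action is additive in the degrees. -/
theorem wordAction_mem_supported {𝒜 : ℕ → Submodule K A} [SetLike.GradedMonoid 𝒜]
    {d : I → ℕ} (h : IsHomogeneousBasis 𝒜 b (fun x => x.elim 0 d)) {dN : N → ℕ} {dW : W → ℕ}
    (hd : ∀ x n, dW (e (x, n)) = x.elim 0 d + dN n) {m n : ℕ} {a : A} (ha : a ∈ 𝒜 m)
    {v : W →₀ K} (hv : v ∈ Finsupp.supported K K {w | dW w = n}) :
    wordAction b e a v ∈ Finsupp.supported K K {w | dW w = m + n} := by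
  have key (k : N) (r : ℕ) (a : A) (ha : a ∈ 𝒜 r) :
      wordEquiv b e (Finsupp.single k a) ∈
        Finsupp.supported K K {w | dW w = r + dN k} := by
    rw [h] at ha
    induction ha using Submodule.span_induction with
    | mem a hxa =>
      obtain ⟨x, rfl, rfl⟩ := hxa
      rw [wordEquiv_single]
      exact Finsupp.single_mem_supported K 1 (hd x k)
    | zero => simp
    | add x y _ _ hx hy =>
      rw [Finsupp.single_add, map_add]
      exact add_mem hx hy
    | smul r x _ hx =>
      rw [← Finsupp.smul_single, map_smul]
      exact Submodule.smul_mem _ r hx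
  rw [Finsupp.supported_eq_span_single] at hv
  induction hv using Submodule.span_induction with
  | mem v hxv =>
    obtain ⟨w, rfl, rfl⟩ := hxv
    obtain ⟨⟨x, k⟩, rfl⟩ := e.surjective w
    simp only
    rw [← wordEquiv_single b e, wordAction_wordEquiv, Finsupp.smul_single, hd, ← add_assoc]
    exact key k _ _ (SetLike.mul_mem_graded ha (h.mem x))
  | zero => simp
  | add x y _ _ hx hy =>
    rw [map_add]
    exact add_mem hx hy
  | smul r x _ hx =>
    rw [map_smul]
    exact Submodule.smul_mem _ r hx

end Action

variable {K : Type*} [Field K] {A : Type*} [Ring A] [Algebra K A]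
  {B : Type*} [Ring B] [Algebra K B] (P : Presentation K A) (Q : Presentation K B)

/-! ### The universal property of the free product -/

/-- The projection of the free algebra onto a presented algebra. -/
noncomputable def Presentation.proj : FreeAlgebra K P.Gen →ₐ[K] A :=
  P.equiv.toAlgHom.comp (RingQuot.mkAlgHom K _)

theorem Presentation.proj_surjective : Function.Surjective P.proj :=
  P.equiv.surjective.comp (RingQuot.mkAlgHom_surjective K _)

theorem Presentation.proj_eq_zero {f : FreeAlgebra K P.Gen} (hf : f ∈ P.rels) :
    P.proj f = 0 := by
  have : RingQuot.mkAlgHom K (fun f g => f ∈ P.rels ∧ g = 0) f =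
      RingQuot.mkAlgHom K (fun f g => f ∈ P.rels ∧ g = 0) 0 :=
    RingQuot.mkAlgHom_rel K ⟨hf, rfl⟩
  show P.equiv (RingQuot.mkAlgHom K (fun f g => f ∈ P.rels ∧ g = 0) f) = 0
  rw [this, map_zero, map_zero]

/-- The projection of the free algebra onto the free product. -/
noncomputable def freeProdProj : FreeAlgebra K (P.Gen ⊕ Q.Gen) →ₐ[K] FreeProd P Q :=
  RingQuot.mkAlgHom K (fun f g => f ∈ unionRels P Q ∧ g = 0)

theorem freeProdProj_surjective : Function.Surjective (freeProdProj P Q) :=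
  RingQuot.mkAlgHom_surjective K _

theorem inl_proj (p : FreeAlgebra K P.Gen) :
    inl P Q (P.proj p) = freeProdProj P Q (freeMap K Sum.inl p) := by
  simp [inl, Presentation.proj, freeProdProj]

theorem inr_proj (q : FreeAlgebra K Q.Gen) :
    inr P Q (Q.proj q) = freeProdProj P Q (freeMap K Sum.inr q) := by
  simp [inr, Presentation.proj, freeProdProj]

/-- The free product is generated by the images of its two factors. -/
theorem freeProd_induction {p : FreeProd P Q → Prop}
    (hscalar : ∀ r, p (algebraMap K _ r)) (hinl : ∀ a, p (inl P Q a)) (hinr : ∀ b, p (inr P Q b))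
    (hmul : ∀ x y, p x → p y → p (x * y)) (hadd : ∀ x y, p x → p y → p (x + y))
    (x : FreeProd P Q) : p x := by
  obtain ⟨f, rfl⟩ := freeProdProj_surjective P Q x
  induction f with
  | grade0 r => simpa only [AlgHom.commutes] using hscalar r
  | grade1 x =>
    rcases x with x | y
    · simpa [inl_proj, freeMap] using hinl (P.proj (FreeAlgebra.ι K x))
    · simpa [inr_proj, freeMap] using hinr (Q.proj (FreeAlgebra.ι K y))
  | mul a b ha hb => simpa only [map_mul] using hmul _ _ ha hb
  | add a b ha hb => simpa only [map_add] using hadd _ _ ha hb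

section Lift

variable {D : Type*} [Semiring D] [Algebra K D] (f : A →ₐ[K] D) (g : B →ₐ[K] D)

/-- The homomorphism from the free algebra on the disjoint union of the generators induced by
homomorphisms from both factors. -/
noncomputable def freeLift : FreeAlgebra K (P.Gen ⊕ Q.Gen) →ₐ[K] D :=
  FreeAlgebra.lift K (Sum.elim (fun x => f (P.proj (FreeAlgebra.ι K x)))
    (fun y => g (Q.proj (FreeAlgebra.ι K y))))

theorem freeLift_inl (p : FreeAlgebra K P.Gen) :
    freeLift P Q f g (freeMap K Sum.inl p) = f (P.proj p) := by
  have : (freeLift P Q f g).comp (freeMap K Sum.inl) = f.comp P.proj := by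
    ext x
    simp [freeLift, freeMap]
  exact AlgHom.congr_fun this p

theorem freeLift_inr (q : FreeAlgebra K Q.Gen) :
    freeLift P Q f g (freeMap K Sum.inr q) = g (Q.proj q) := by
  have : (freeLift P Q f g).comp (freeMap K Sum.inr) = g.comp Q.proj := by
    ext x
    simp [freeLift, freeMap]
  exact AlgHom.congr_fun this q

/-- The homomorphism from the free product induced by homomorphisms from both factors. -/
noncomputable def freeProdLift : FreeProd P Q →ₐ[K] D :=
  RingQuot.liftAlgHom K ⟨freeLift P Q f g, by
    rintro _ _ ⟨⟨p, hp, rfl⟩ | ⟨q, hq, rfl⟩, rfl⟩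
    · rw [freeLift_inl, P.proj_eq_zero hp, map_zero, map_zero]
    · rw [freeLift_inr, Q.proj_eq_zero hq, map_zero, map_zero]⟩

theorem freeProdLift_inl (a : A) : freeProdLift P Q f g (inl P Q a) = f a := by
  obtain ⟨p, rfl⟩ := P.proj_surjective a
  rw [inl_proj, freeProdLift, freeProdProj, RingQuot.liftAlgHom_mkAlgHom_apply, freeLift_inl]

theorem freeProdLift_inr (b : B) : freeProdLift P Q f g (inr P Q b) = g b := by
  obtain ⟨q, rfl⟩ := Q.proj_surjective b
  rw [inr_proj, freeProdLift, freeProdProj, RingQuot.liftAlgHom_mkAlgHom_apply, freeLift_inr]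

end Lift

/-! ### The basis of the free product consisting of alternating words -/

section WordBasis

variable {L : Bool → Type} (bA : Basis (Option (L true)) K A) (bB : Basis (Option (L false)) K B)

/-- The letters, as elements of the free product. -/
noncomputable def letter : ∀ c, L c → FreeProd P Q
  | true, i => inl P Q (bA (some i))
  | false, j => inr P Q (bB (some j))

/-- The action of the free product on the vector space of alternating words. -/
noncomputable def wordRep : FreeProd P Q →ₐ[K] Module.End K (AltWord L none →₀ K) :=
  freeProdLift P Q (wordAction bA (AltWord.prependEquiv L true))
    (wordAction bB (AltWord.prependEquiv L false))

/-- The linear map from the vector space of alternating words to the free product which sends each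
word to its product. -/
noncomputable def valMap : (AltWord L none →₀ K) →ₗ[K] FreeProd P Q :=
  Finsupp.linearCombination K (AltWord.val (letter P Q bA bB))

theorem valMap_single (w : AltWord L none) :
    valMap P Q bA bB (Finsupp.single w 1) = AltWord.val (letter P Q bA bB) w := by
  simp [valMap]

variable {bA bB} (hbA : bA none = 1) (hbB : bB none = 1)

include hbA hbB

/-- Acting by the letters from right to left rebuilds the word: alternation ensures that each letter
meets a word it can simply be put in front of. This yields linear independence. -/
theorem wordRep_val {b : Option Bool} (w : AltWord L b) :
    wordRep P Q bA bB (AltWord.val (letter P Q bA bB) w) (Finsupp.single AltWord.nil 1) =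
      Finsupp.single w.forget 1 := by
  induction w with
  | nil => simp [AltWord.val, AltWord.forget]
  | cons c h i w ih =>
    rw [AltWord.val, map_mul, Module.End.mul_apply, ih]
    cases c
    · rw [letter, wordRep, freeProdLift_inr]
      exact wordAction_single bB (AltWord.prependEquiv L false) hbB (some i) w
    · rw [letter, wordRep, freeProdLift_inl]
      exact wordAction_single bA (AltWord.prependEquiv L true) hbA (some i) w

/-- Equivariance need only be checked for the two factors, which generate. At the empty word it
shows that the words span. -/
theorem valMap_wordRep (x : FreeProd P Q) (v : AltWord L none →₀ K) :
    valMap P Q bA bB (wordRep P Q bA bB x v) = x * valMap P Q bA bB v := by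
  induction x using freeProd_induction generalizing v with
  | hscalar r => simp [Algebra.smul_def]
  | hinl a =>
    rw [wordRep, freeProdLift_inl]
    refine map_wordAction bA _ (inl P Q) (AltWord.val (letter P Q bA bB)) _ (fun x w => ?_) a v
    rw [valMap_single]
    cases x with
    | none =>
      rw [hbA, map_one, one_mul]
      exact AltWord.val_forget _ w
    | some i => rfl
  | hinr b =>
    rw [wordRep, freeProdLift_inr]
    refine map_wordAction bB _ (inr P Q) (AltWord.val (letter P Q bA bB)) _ (fun x w => ?_) b v
    rw [valMap_single]
    cases x with
    | none =>
      rw [hbB, map_one, one_mul]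
      exact AltWord.val_forget _ w
    | some i => rfl
  | hmul x y hx hy => rw [map_mul, Module.End.mul_apply, hx, hy, mul_assoc]
  | hadd x y hx hy => rw [map_add, LinearMap.add_apply, map_add, hx, hy, add_mul]

/-- The alternating words form a basis of the free product. -/
noncomputable def wordBasis : Basis (AltWord L none) K (FreeProd P Q) :=
  Basis.ofRepr <| LinearEquiv.ofLinearMap
    (LinearMap.applyₗ (Finsupp.single AltWord.nil 1) ∘ₗ (wordRep P Q bA bB).toLinearMap)
    (valMap P Q bA bB)
    (Finsupp.basisSingleOne.ext fun w => by
      have : w.forget = w := by cases w <;> rfl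
      simp [valMap_single, wordRep_val P Q hbA hbB, this])
    (LinearMap.ext fun x => by
      simp [valMap_wordRep P Q hbA hbB, valMap_single, AltWord.val])

theorem wordBasis_apply (w : AltWord L none) :
    wordBasis P Q hbA hbB w = AltWord.val (letter P Q bA bB) w :=
  valMap_single P Q bA bB w

theorem wordBasis_repr (x : FreeProd P Q) :
    (wordBasis P Q hbA hbB).repr x = wordRep P Q bA bB x (Finsupp.single AltWord.nil 1) :=
  rfl

end WordBasis

/-! ### The grading of the free product -/

section Grading

theorem IsWord.mul {P : Presentation K A} {Q : Presentation K B} {𝒜 : ℕ → Submodule K A}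
    {ℬ : ℕ → Submodule K B} {m n : ℕ} {x y : FreeProd P Q}
    (hx : IsWord P Q 𝒜 ℬ m x) (hy : IsWord P Q 𝒜 ℬ n y) : IsWord P Q 𝒜 ℬ (m + n) (x * y) := by
  induction hx with
  | one => simpa using hy
  | left ha _ ih =>
    rw [add_assoc, mul_assoc]
    exact .left ha ih
  | right hb _ ih =>
    rw [add_assoc, mul_assoc]
    exact .right hb ih

theorem freeProdGrading_gradedMonoid (𝒜 : ℕ → Submodule K A) (ℬ : ℕ → Submodule K B) :
    SetLike.GradedMonoid (freeProdGrading P Q 𝒜 ℬ) where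
  one_mem := Submodule.subset_span .one
  mul_mem m n x y hx hy := by
    have := Submodule.mul_mem_mul hx hy
    rw [freeProdGrading, freeProdGrading, Submodule.span_mul_span] at this
    refine Submodule.span_mono ?_ this
    rintro _ ⟨x, hx, y, hy, rfl⟩
    exact IsWord.mul hx hy

variable {L : Bool → Type} {bA : Basis (Option (L true)) K A} {bB : Basis (Option (L false)) K B}
  (hbA : bA none = 1) (hbB : bB none = 1)
  {𝒜 : ℕ → Submodule K A} {ℬ : ℕ → Submodule K B} {d : ∀ c, L c → ℕ}
  (h𝒜 : IsHomogeneousBasis 𝒜 bA (fun x => x.elim 0 (d true)))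
  (hℬ : IsHomogeneousBasis ℬ bB (fun x => x.elim 0 (d false)))

include h𝒜 hℬ in
theorem isWord_val {b : Option Bool} (w : AltWord L b) :
    IsWord P Q 𝒜 ℬ (AltWord.deg d w) (AltWord.val (letter P Q bA bB) w) := by
  induction w with
  | nil => exact .one
  | cons c h i w ih =>
    cases c
    · exact .right (hℬ.mem (some i)) ih
    · exact .left (h𝒜.mem (some i)) ih

include h𝒜 hℬ in
/-- The basis of alternating words is homogeneous. -/
theorem isHomogeneousBasis_wordBasis [SetLike.GradedMonoid 𝒜] [SetLike.GradedMonoid ℬ] :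
    IsHomogeneousBasis (freeProdGrading P Q 𝒜 ℬ) (wordBasis P Q hbA hbB) (AltWord.deg d) := by
  intro n
  apply le_antisymm
  · refine Submodule.span_le.mpr fun x hx => ?_
    -- The coordinates of a product arise by letting its factors act successively on the empty word,
    -- and each factor shifts degrees by its own degree.
    refine (wordBasis P Q hbA hbB).mem_span_image.mpr ?_
    rw [wordBasis_repr, ← Finsupp.mem_supported K]
    induction hx with
    | one =>
      rw [map_one, Module.End.one_apply]
      exact Finsupp.single_mem_supported K 1 rfl
    | left ha _ ih =>
      rw [map_mul, Module.End.mul_apply, wordRep, freeProdLift_inl]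
      exact wordAction_mem_supported bA _ h𝒜 (AltWord.deg_prepend d true) ha ih
    | right hb _ ih =>
      rw [map_mul, Module.End.mul_apply, wordRep, freeProdLift_inr]
      exact wordAction_mem_supported bB _ hℬ (AltWord.deg_prepend d false) hb ih
  · refine Submodule.span_mono ?_
    rintro _ ⟨w, rfl, rfl⟩
    rw [wordBasis_apply]
    exact isWord_val P Q h𝒜 hℬ w

end Grading

/-- The letters belonging to homogeneous bases of the two factors. -/
abbrev pairLetters (I J : Type) (c : Bool) : Type := cond c I J

/-- The degrees of the letters belonging to homogeneous bases of the two factors. -/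
def pairDeg {I J : Type} (dI : I → ℕ) (dJ : J → ℕ) : ∀ c, pairLetters I J c → ℕ
  | true => dI
  | false => dJ

end FreeProductHilbert

/-- The induced grading of the free product of two connected graded algebras with
finite-dimensional components is again such a grading, and the Hilbert series satisfy
`H_{A * B}⁻¹ = H_A⁻¹ + H_B⁻¹ - 1`. (All three series have constant term `1`, so the inverses are
true inverses of formal power series.) -/
theorem theorem7p3p1 {K : Type*} [Field K]
    {A : Type*} [Ring A] [Algebra K A] {B : Type*} [Ring B] [Algebra K B]
    (P : FreeProductHilbert.Presentation K A) (Q : FreeProductHilbert.Presentation K B)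
    (𝒜 : ℕ → Submodule K A) [GradedAlgebra 𝒜] (ℬ : ℕ → Submodule K B) [GradedAlgebra ℬ]
    (hA : FreeProductHilbert.IsConnectedGrading 𝒜)
    (hB : FreeProductHilbert.IsConnectedGrading ℬ)
    (hAfin : ∀ n, Module.Finite K (𝒜 n)) (hBfin : ∀ n, Module.Finite K (ℬ n)) :
    Nonempty (GradedAlgebra (FreeProductHilbert.freeProdGrading P Q 𝒜 ℬ)) ∧
    FreeProductHilbert.IsConnectedGrading (FreeProductHilbert.freeProdGrading P Q 𝒜 ℬ) ∧
    (∀ n, Module.Finite K (FreeProductHilbert.freeProdGrading P Q 𝒜 ℬ n)) ∧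
    (FreeProductHilbert.hilbertSeries (FreeProductHilbert.freeProdGrading P Q 𝒜 ℬ))⁻¹ =
      (FreeProductHilbert.hilbertSeries 𝒜)⁻¹ + (FreeProductHilbert.hilbertSeries ℬ)⁻¹ - 1 := by
  open FreeProductHilbert in
  obtain ⟨I, bA, dI, hdI, hbA, h𝒜⟩ := exists_isHomogeneousBasis hA hAfin
  obtain ⟨J, bB, dJ, hdJ, hbB, hℬ⟩ := exists_isHomogeneousBasis hB hBfin
  have hd : ∀ c i, pairDeg dI dJ c i ≠ 0 := by
    rintro (_ | _) i
    · exact hdJ i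
    · exact hdI i
  have hfin : ∀ c n, {i | pairDeg dI dJ c i = n}.Finite := by
    rintro (_ | _) n
    · exact ((hℬ.finite_iff n).mp (hBfin n)).preimage (Option.some_injective J).injOn
    · exact ((h𝒜.finite_iff n).mp (hAfin n)).preimage (Option.some_injective I).injOn
  -- `pairLetters` and `pairDeg` reduce definitionally at `true` and `false`, so the bases chosen
  -- above fit without transport.
  have h := isHomogeneousBasis_wordBasis (L := pairLetters I J) (d := pairDeg dI dJ) P Q
    hbA hbB h𝒜 hℬ
  have := freeProdGrading_gradedMonoid P Q 𝒜 ℬ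
  refine ⟨⟨{ toDecomposition := h.decomposition }⟩, ⟨?_, ?_⟩, fun n => ?_, ?_⟩
  · have : Nonempty (AltWord (pairLetters I J) none) := ⟨.nil⟩
    exact (wordBasis (L := pairLetters I J) P Q hbA hbB).repr.toEquiv.nontrivial
  · have hnil : {w : AltWord (pairLetters I J) none | w.deg (pairDeg dI dJ) = 0} = {.nil} :=
      Set.ext fun w => ⟨AltWord.eq_nil_of_deg_eq_zero hd, fun hw => hw ▸ rfl⟩
    rw [h 0, hnil, Set.image_singleton, wordBasis_apply, Submodule.one_eq_span]
    rfl
  · exact (h.finite_iff n).mpr (AltWord.finite_deg_eq hd hfin none n)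
  · rw [h.hilbertSeries_eq, h𝒜.hilbertSeries_eq, hℬ.hilbertSeries_eq]
    exact AltWord.inv_countSeries hd hfin
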